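/- Let $n\ge 1$ and let $a_1,\dots,a_n$ be the annihilation operators on the Fock space $\mathcal F\cong\mathbb C^{2^n}$ of $n$ fermionic modes, with Majorana operators $\omega_{2j-1}=a_j+a_j^\dagger$, $\omega_{2j}=i(a_j-a_j^\dagger)$, so that $\{\omega_i,\omega_j\}=2\delta_{ij}$. Let $h\in\mathbb C^{2n\times 2n}$ be Hermitian and antisymmetric ($h^T=-h$), with eigenvalues $\epsilon_1,\dots,\epsilon_{2n}\in\mathbb R$ listed with multiplicity, and let $H_0=\sum_{i,j}\omega_i h_{ij}\omega_j$. Let $\beta\in\mathbb R$, let $q:\mathbb R\to\mathbb R$ be even, $q(-\nu)=q(\nu)$, and put $\hat f(\nu)=q(\nu)e^{-\beta\nu/4}$. For an operator $A$ on $\mathcal F$ and a Bohr frequency $\nu\in B=\{E-E' : E,E'\in\operatorname{spec}(H_0)\}$ let $A_\nu=\sum_{E-E'=\nu}P_EAP_{E'}$, where $P_E$ is the projector onto the eigenspace of $H_0$ with eigenvalue $E$. Put $L_a=\sum_{\nu\in B}\hat f(\nu)(\omega_a)_\nu$ for $a=1,\dots,2n$ and $G=\frac i2\sum_a\sum_{\nu\in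 B}\tanh(\beta\nu/4)\,(L_a^\dagger L_a)_\nu$, and let $$\mathcal L_0^\dagger[\rho]=-i[G,\rho]+\sum_{a=1}^{2n}\Big(L_a\rho L_a^\dagger-\tfrac12\{L_a^\dagger L_a,\rho\}\Big)$$ act on the space of all operators on $\mathcal F$. Then: 1. The spectrum of $\mathcal L_0^\dagger$ is real, and $$\operatorname{spec}(\mathcal L_0^\dagger)=\Big\{\sum_{i=1}^{2n}\big(-1+(-1)^{x_i}\big)\,q(4\epsilon_i)^2\cosh(2\beta\epsilon_i)\Big\}_{x\in\{0,1\}^{2n}},$$ both as a set and as a multiset of eigenvalues with algebraic multiplicities. 2. Counting eigenvalues with multiplicity, the gap between the highest and the second highest eigenvalue of $\mathcal L_0^\dagger$ is $$\Delta_0=2\min_i q(4\epsilon_i)^2\cosh(2\beta\epsilon_i),$$ and the gap between the lowest and the second lowest eigenvalue has the same value. 3. The Gibbs state $\sigma_\beta=e^{-\beta H_0}/\operatorname{Tr}e^{-\beta H_0}$ is a density matrix with $\mathcal L_0^\dagger[\sigma_\beta]=0$. If $q(4\epsilon_i)\neq0$ for all $i$ (equivalently $\Delta_0>0$), then $\ker\mathcal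 L_0^\dagger=\mathbb C\,\sigma_\beta$; in particular $\sigma_\beta$ is the unique density matrix $\rho$ with $\mathcal L_0^\dagger[\rho]=0$. -/

import Mathlib

open scoped ComplexOrder Matrix

noncomputable section

/-- Occupation strings `x ∈ {0,1}ⁿ`, which label the standard orthonormal basis
`|x⟩ = (a₁†)^{x₁} ⋯ (aₙ†)^{xₙ} |0ⁿ⟩` of the Fock space of `n` fermionic modes. -/
abbrev Occ (n : ℕ) : Type := Fin n → Fin 2

/-- Operators on the Fock space, written as matrices in the basis `|x⟩`. -/
abbrev FockOp (n : ℕ) : Type := Matrix (Occ n) (Occ n) ℂ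

/-- The annihilation operator `a_j`: `a_j |x⟩ = (-1)^{x₁ + ⋯ + x_{j-1}} |x - e_j⟩` if `x_j = 1`,
and `a_j |x⟩ = 0` if `x_j = 0`. The entry at `(y, x)` is `⟨y| a_j |x⟩`. -/
def annihilation {n : ℕ} (j : Fin n) : FockOp n :=
  Matrix.of fun y x =>
    if x j = 1 ∧ y = Function.update x j 0 then (-1 : ℂ) ^ (∑ i ∈ Finset.Iio j, (x i : ℕ)) else 0

/-- The Majorana operators `ω_{2j-1} = a_j + a_j†` and `ω_{2j} = i (a_j - a_j†)`; indices start
at zero here, so that the mode `k / 2` carries the Majorana operators number `2 (k / 2)` and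
`2 (k / 2) + 1`. -/
def majorana {n : ℕ} (k : Fin (2 * n)) : FockOp n :=
  let a : FockOp n := annihilation (⟨(k : ℕ) / 2, by omega⟩ : Fin n)
  if (k : ℕ) % 2 = 0 then a + aᴴ else Complex.I • (a - aᴴ)

theorem majorana_isHermitian {n : ℕ} (k : Fin (2 * n)) : (majorana k).IsHermitian := by
  unfold Matrix.IsHermitian majorana
  dsimp only
  split_ifs
  · simp [add_comm]
  · rw [Matrix.conjTranspose_smul, Matrix.conjTranspose_sub, Matrix.conjTranspose_conjTranspose]
    simp [sub_eq_add_neg, add_comm]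

/-- The quadratic Hamiltonian `H₀ = ωᵀ h ω = ∑_{i,j} ω_i h_{ij} ω_j`. -/
def freeHamiltonian {n : ℕ} (h : Matrix (Fin (2 * n)) (Fin (2 * n)) ℂ) : FockOp n :=
  ∑ i, ∑ j, h i j • (majorana i * majorana j)

theorem freeHamiltonian_isHermitian {n : ℕ} {h : Matrix (Fin (2 * n)) (Fin (2 * n)) ℂ}
    (hh : h.IsHermitian) : (freeHamiltonian h).IsHermitian := by
  unfold Matrix.IsHermitian freeHamiltonian
  rw [Matrix.conjTranspose_sum, Finset.sum_comm]
  refine Finset.sum_congr rfl fun i _ => ?_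
  rw [Matrix.conjTranspose_sum]
  refine Finset.sum_congr rfl fun j _ => ?_
  rw [Matrix.conjTranspose_smul, Matrix.conjTranspose_mul, (majorana_isHermitian i).eq,
    (majorana_isHermitian j).eq, hh.apply]

section Lindbladian

variable {m : Type*} [Fintype m] [DecidableEq m]

/-- The finite set of eigenvalues of the Hermitian matrix `H`. -/
def energies {H : Matrix m m ℂ} (hH : H.IsHermitian) : Finset ℝ :=
  Finset.univ.image hH.eigenvalues

/-- The spectral projector of `H` at `E`, that is, the indicator function of `{E}` applied to `H`:
the orthogonal projector onto the eigenspace of `H` with eigenvalue `E`. -/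
def energyProj {H : Matrix m m ℂ} (hH : H.IsHermitian) (E : ℝ) : Matrix m m ℂ :=
  hH.cfc fun x => if x = E then 1 else 0

/-- The set of Bohr frequencies `{E - E'}`, with `E, E'` in the spectrum of `H`. -/
def bohrFreqs {H : Matrix m m ℂ} (hH : H.IsHermitian) : Finset ℝ :=
  (energies hH ×ˢ energies hH).image fun p => p.1 - p.2

/-- The component `A_ν = ∑_{E - E' = ν} P_E A P_{E'}` of `A` at the Bohr frequency `ν`. -/
def bohrComponent {H : Matrix m m ℂ} (hH : H.IsHermitian) (A : Matrix m m ℂ) (ν : ℝ) :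
    Matrix m m ℂ :=
  ∑ p ∈ (energies hH ×ˢ energies hH).filter (fun p => p.1 - p.2 = ν),
    energyProj hH p.1 * A * energyProj hH p.2

/-- The Lindblad operator `L = ∑_ν f̂(ν) A_ν` of the jump operator `A` and the filter
function `f̂`. -/
def lindbladOp {H : Matrix m m ℂ} (hH : H.IsHermitian) (f : ℝ → ℂ) (A : Matrix m m ℂ) :
    Matrix m m ℂ :=
  ∑ ν ∈ bohrFreqs hH, f ν • bohrComponent hH A ν

variable {ι : Type*} [Fintype ι]

/-- The coherent term `G = (i/2) ∑_a ∑_ν tanh(β ν / 4) (L_a† L_a)_ν`. -/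
def coherentTerm {H : Matrix m m ℂ} (hH : H.IsHermitian) (β : ℝ) (f : ι → ℝ → ℂ)
    (A : ι → Matrix m m ℂ) : Matrix m m ℂ :=
  (Complex.I / 2) • ∑ a, ∑ ν ∈ bohrFreqs hH, ((Real.tanh (β * ν / 4) : ℝ) : ℂ) •
    bohrComponent hH ((lindbladOp hH (f a) (A a))ᴴ * lindbladOp hH (f a) (A a)) ν

/-- The Lindblad generator in the Schrödinger picture, with coherent term `G` and Lindblad
operators `L_a`:
`ρ ↦ -i [G, ρ] + ∑_a (L_a ρ L_a† - (1/2) (L_a† L_a ρ + ρ L_a† L_a))`. -/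
def lindbladGenerator (G : Matrix m m ℂ) (L : ι → Matrix m m ℂ) :
    Module.End ℂ (Matrix m m ℂ) where
  toFun ρ := -Complex.I • (G * ρ - ρ * G) +
    ∑ a, (L a * ρ * (L a)ᴴ - (1 / 2 : ℂ) • ((L a)ᴴ * L a * ρ + ρ * ((L a)ᴴ * L a)))
  map_add' ρ τ := by
    simp only [mul_add, add_mul, smul_add, smul_sub, Finset.sum_add_distrib,
      Finset.sum_sub_distrib]
    abel
  map_smul' c ρ := by
    simp only [Matrix.mul_smul, Matrix.smul_mul, RingHom.id_apply, smul_add, smul_sub,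
      Finset.smul_sum, smul_comm c]

/-- The Lindbladian at inverse temperature `β` built from the Hamiltonian `H`, the filter
functions `f̂^a` and the jump operators `A^a`. -/
def gibbsLindbladian {H : Matrix m m ℂ} (hH : H.IsHermitian) (β : ℝ) (f : ι → ℝ → ℂ)
    (A : ι → Matrix m m ℂ) : Module.End ℂ (Matrix m m ℂ) :=
  lindbladGenerator (coherentTerm hH β f A) fun a => lindbladOp hH (f a) (A a)

/-- The Gibbs state `σ_β = e^{-βH} / Tr e^{-βH}`. -/
def gibbsState (β : ℝ) (H : Matrix m m ℂ) : Matrix m m ℂ :=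
  (NormedSpace.exp (-(β : ℂ) • H)).trace⁻¹ • NormedSpace.exp (-(β : ℂ) • H)

/-- Density matrices: positive semidefinite matrices of trace one. -/
def IsDensityMatrix (ρ : Matrix m m ℂ) : Prop := ρ.PosSemidef ∧ ρ.trace = 1

end Lindbladian

section Gap

variable {V : Type*} [AddCommGroup V] [Module ℂ V] [Module.Finite ℂ V] [Module.Free ℂ V]

/-- The eigenvalues of `T`, each repeated according to its algebraic multiplicity. -/
def eigenvalueMultiset (T : Module.End ℂ V) : Multiset ℂ := T.charpoly.roots

/-- The gap between the highest and the second highest eigenvalue of an operator with real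
spectrum, eigenvalues being counted with multiplicity. -/
def topGap (T : Module.End ℂ V) : ℝ :=
  let l : List ℝ := ((eigenvalueMultiset T).map Complex.re).sort (fun a b => b ≤ a)
  l.getD 0 0 - l.getD 1 0

/-- The gap between the second lowest and the lowest eigenvalue of an operator with real
spectrum, eigenvalues being counted with multiplicity. -/
def bottomGap (T : Module.End ℂ V) : ℝ :=
  let l : List ℝ := ((eigenvalueMultiset T).map Complex.re).sort (fun a b => a ≤ b)
  l.getD 1 0 - l.getD 0 0

end Gap

/-- The Lindbladian of the free fermionic Hamiltonian `H₀ = ωᵀ h ω` at inverse temperature `β`,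
with the `2n` Majorana operators as jump operators, all with the same real filter function
`f̂(ν) = q(ν) e^{-βν/4}`. -/
def freeLindbladian {n : ℕ} {h : Matrix (Fin (2 * n)) (Fin (2 * n)) ℂ} (hh : h.IsHermitian)
    (β : ℝ) (q : ℝ → ℝ) : Module.End ℂ (FockOp n) :=
  gibbsLindbladian (freeHamiltonian_isHermitian hh) β
    (fun _ ν => ((q ν * Real.exp (-β * ν / 4) : ℝ) : ℂ)) (majorana (n := n))

end

/-! On w(v) = ∑ v_k ω_k, commuting with H₀ acts as 4 w(hv) (`freeHamiltonian_commutator`), so an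
eigenvector v_i of h gives an eigenmode w(v_i) of Bohr frequency 4ε_i. Unitarity of the eigenvector
matrix turns the sum over jump operators into a sum over eigenmodes (`sum_bilin_lindbladOp`). In
particular ∑ L_a†L_a commutes with H₀, so G = 0, and the generator is a sum of eigenmode dissipators
with rates q(4ε)² e^{-2βε}.

Third quantization diagonalizes this sum. Left and right multiplication by w(v), twisted by the
fermion parity, combine into c = l + r and d = l - r, with {c,c} = {d,d} = 0 and {c(u),d(v)} = 4
u·v. Each dissipator is quadratic in c and d, with c on the left (`dissipator_majoranaComb`). Since
h is antisymmetric, conjugating eigenvectors sends ε to -ε (`sum_bilin_star_eigvec`). Symmetrizing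
the rates and absorbing the cc terms into d by a shift tanh(2βε) gives -2 ∑ κ_i C_i A_i with κ_i =
q(4ε_i)² cosh(2βε_i), where C and A satisfy the canonical anticommutation relations
(`freeLindbladian_eq_sum_normal`). In dimension 2^{2n} the operators C_i A_i have a joint eigenbasis
in which each occupation string appears once (`exists_occupation_basis`); this yields spectrum,
multiplicities and gaps.

The Gibbs state is stationary by detailed balance (`freeLindbladian_exp`), and unique when all κ_i >
0, because only the empty string then has eigenvalue 0. -/

/-! ### Jordan–Wigner signs and the Clifford relations -/

/-- Flip the occupation of the mode `j`. -/
def occFlip {n : ℕ} (j : Fin n) (x : Occ n) : Occ n := Function.update x j (1 - x j)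

/-- The sign `(-1)^b` of an occupation number `b`. -/
def occSign (b : Fin 2) : ℂ := (-1) ^ (b : ℕ)

theorem occSign_one_sub (b : Fin 2) : occSign (1 - b) = -occSign b := by
  fin_cases b <;> simp [occSign]

theorem occSign_mul_self (b : Fin 2) : occSign b * occSign b = 1 := by
  fin_cases b <;> simp [occSign]

theorem occFlip_occFlip {n : ℕ} (j : Fin n) (x : Occ n) : occFlip j (occFlip j x) = x := by
  simp [occFlip]

theorem occFlip_comm {n : ℕ} (i j : Fin n) (x : Occ n) :
    occFlip i (occFlip j x) = occFlip j (occFlip i x) := by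
  by_cases hij : i = j
  · rw [hij]
  · simp [occFlip, Function.update_of_ne hij, Function.update_of_ne (Ne.symm hij),
      Function.update_comm hij]

/-- The Jordan–Wigner sign of the mode `j`. -/
def jwSign {n : ℕ} (j : Fin n) (x : Occ n) : ℂ := ∏ i ∈ Finset.Iio j, occSign (x i)

theorem prod_occSign_mul_self {n : ℕ} (s : Finset (Fin n)) (x : Occ n) :
    (∏ i ∈ s, occSign (x i)) * ∏ i ∈ s, occSign (x i) = 1 := by
  rw [← Finset.prod_mul_distrib]
  simp [occSign_mul_self]

theorem prod_occSign_occFlip {n : ℕ} (s : Finset (Fin n)) (j : Fin n) (x : Occ n) :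
    ∏ i ∈ s, occSign (occFlip j x i) =
      (if j ∈ s then -1 else 1) * ∏ i ∈ s, occSign (x i) := by
  split_ifs with hj
  · rw [← Finset.mul_prod_erase s _ hj, ← Finset.mul_prod_erase s _ hj]
    have : ∏ i ∈ s.erase j, occSign (occFlip j x i) = ∏ i ∈ s.erase j, occSign (x i) :=
      Finset.prod_congr rfl fun i hi => by
        rw [occFlip, Function.update_of_ne (Finset.ne_of_mem_erase hi)]
    rw [this, occFlip, Function.update_self, occSign_one_sub]
    ring
  · rw [one_mul]
    refine Finset.prod_congr rfl fun i hi => ?_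
    rw [occFlip, Function.update_of_ne (by rintro rfl; exact hj hi)]

/-- The mode that carries the Majorana operator number `k`. -/
def majoranaMode {n : ℕ} (k : Fin (2 * n)) : Fin n := ⟨(k : ℕ) / 2, by omega⟩

/-- The phase in `ω_k |x⟩ = phase |x ⊕ e_j⟩`. -/
def majoranaPhase {n : ℕ} (k : Fin (2 * n)) (x : Occ n) : ℂ :=
  (if (k : ℕ) % 2 = 0 then 1 else -Complex.I * occSign (x (majoranaMode k))) *
    jwSign (majoranaMode k) x

theorem annihilation_apply {n : ℕ} (j : Fin n) (y x : Occ n) :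
    annihilation j y x = if x j = 1 ∧ y = occFlip j x then jwSign j x else 0 := by
  have : (-1 : ℂ) ^ (∑ i ∈ Finset.Iio j, (x i : ℕ)) = jwSign j x := by
    simp [jwSign, occSign, Finset.prod_pow_eq_pow_sum]
  simp only [annihilation, Matrix.of_apply, this]
  by_cases hx : x j = 1 <;> simp [hx, occFlip]

theorem jwSign_occFlip_self {n : ℕ} (j : Fin n) (x : Occ n) :
    jwSign j (occFlip j x) = jwSign j x := by
  simp [jwSign, prod_occSign_occFlip]

theorem star_jwSign {n : ℕ} (j : Fin n) (x : Occ n) : star (jwSign j x) = jwSign j x := by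
  simp [jwSign, occSign]

theorem annihilation_conjTranspose_apply {n : ℕ} (j : Fin n) (y x : Occ n) :
    (annihilation j)ᴴ y x = if x j = 0 ∧ y = occFlip j x then jwSign j x else 0 := by
  rw [Matrix.conjTranspose_apply, annihilation_apply]
  have : (y j = 1 ∧ x = occFlip j y) ↔ (x j = 0 ∧ y = occFlip j x) := by
    constructor
    · rintro ⟨h1, rfl⟩
      exact ⟨by simp [occFlip, h1], (occFlip_occFlip j y).symm⟩
    · rintro ⟨h1, rfl⟩
      exact ⟨by simp [occFlip, h1], (occFlip_occFlip j x).symm⟩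
  simp only [this]
  split_ifs with h
  · rw [star_jwSign, h.2, jwSign_occFlip_self]
  · simp

theorem majorana_apply {n : ℕ} (k : Fin (2 * n)) (y x : Occ n) :
    majorana k y x = if y = occFlip (majoranaMode k) x then majoranaPhase k x else 0 := by
  unfold majorana majoranaPhase
  change (if (k : ℕ) % 2 = 0 then annihilation (majoranaMode k) + (annihilation (majoranaMode k))ᴴ
    else Complex.I • (annihilation (majoranaMode k) - (annihilation (majoranaMode k))ᴴ)) y x = _
  have hx : x (majoranaMode k) = 0 ∨ x (majoranaMode k) = 1 := by
    generalize x (majoranaMode k) = b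
    fin_cases b <;> simp
  split_ifs with hk hy hy <;>
    simp only [Matrix.add_apply, Matrix.smul_apply, Matrix.sub_apply, annihilation_apply,
      annihilation_conjTranspose_apply, hy, and_true, and_false] <;>
    rcases hx with hx | hx <;> simp [hx, occSign]

theorem majorana_mul_apply {n : ℕ} (k : Fin (2 * n)) (A : FockOp n) (y x : Occ n) :
    (A * majorana k) y x = A y (occFlip (majoranaMode k) x) * majoranaPhase k x := by
  rw [Matrix.mul_apply]
  simp [majorana_apply]

/-- The sign changes when the flipped bit lies in the Jordan–Wigner string of `k`, or when it is the
bit of `k` itself and `k` is the second Majorana of its mode, whose phase also reads that bit. -/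
theorem majoranaPhase_occFlip {n : ℕ} (k l : Fin (2 * n)) (x : Occ n) :
    majoranaPhase k (occFlip (majoranaMode l) x) =
      (if majoranaMode l < majoranaMode k ∨ (majoranaMode l = majoranaMode k ∧ (k : ℕ) % 2 = 1)
        then -1 else 1) * majoranaPhase k x := by
  unfold majoranaPhase jwSign
  rw [prod_occSign_occFlip]
  rcases lt_trichotomy (majoranaMode l) (majoranaMode k) with h | h | h
  · simp only [h, occFlip, Function.update_of_ne h.ne', Finset.mem_Iio, if_true, true_or]
    ring
  · rcases Nat.mod_two_eq_zero_or_one (k : ℕ) with hk | hk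
    · simp [h, hk]
    · simp [h, hk, occFlip, occSign_one_sub]
  · simp [h.not_gt, h.ne', occFlip, Function.update_of_ne h.ne]

theorem majoranaPhase_mul_self {n : ℕ} (k : Fin (2 * n)) (x : Occ n) :
    majoranaPhase k (occFlip (majoranaMode k) x) * majoranaPhase k x = 1 := by
  rw [majoranaPhase_occFlip]
  have h1 := prod_occSign_mul_self (Finset.Iio (majoranaMode k)) x
  have h2 := occSign_mul_self (x (majoranaMode k))
  have h3 := Complex.I_mul_I
  unfold majoranaPhase jwSign
  rcases Nat.mod_two_eq_zero_or_one (k : ℕ) with hk | hk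
  · simp [hk, h1]
  · simp only [hk, lt_self_iff_false, and_self, or_true, if_true, one_ne_zero, if_false]
    linear_combination (-(Complex.I * Complex.I) * occSign (x (majoranaMode k)) ^ 2) * h1 -
      Complex.I ^ 2 * h2 - h3

theorem majoranaMode_eq_iff {n : ℕ} (k l : Fin (2 * n)) :
    majoranaMode k = majoranaMode l ↔ (k : ℕ) / 2 = (l : ℕ) / 2 := by
  simp [majoranaMode, Fin.ext_iff]

theorem majorana_mul_self {n : ℕ} (k : Fin (2 * n)) : majorana k * majorana k = 1 := by
  ext y x
  rw [majorana_mul_apply, majorana_apply, occFlip_occFlip, Matrix.one_apply, ite_mul, zero_mul,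
    majoranaPhase_mul_self]

/-- Exactly one of the two orders picks up a minus sign: the modes are ordered, or they agree and
exactly one index is odd. -/
theorem majorana_anticomm_of_ne {n : ℕ} {k l : Fin (2 * n)} (hkl : k ≠ l) :
    majorana k * majorana l + majorana l * majorana k = 0 := by
  ext y x
  rw [Matrix.add_apply, majorana_mul_apply, majorana_mul_apply, majorana_apply, majorana_apply,
    occFlip_comm, majoranaPhase_occFlip, majoranaPhase_occFlip, Matrix.zero_apply]
  split_ifs with h0 h1 h2 h2
  all_goals try ring1
  · exfalso
    rcases h1 with h1 | ⟨h1, h3⟩ <;> rcases h2 with h2 | ⟨h2, h4⟩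
    · exact lt_asymm h1 h2
    · exact absurd h1 (by simp [h2])
    · exact absurd h2 (by simp [h1])
    · rw [majoranaMode_eq_iff] at h1
      exact hkl (Fin.ext (by omega))
  · exfalso
    push Not at h1 h2
    have h3 := le_antisymm h1.1 h2.1
    have h4 := h1.2 h3.symm
    have h5 := h2.2 h3
    rw [majoranaMode_eq_iff] at h3
    exact hkl (Fin.ext (by omega))

theorem majorana_anticomm {n : ℕ} (k l : Fin (2 * n)) :
    majorana k * majorana l + majorana l * majorana k = (if k = l then 2 else 0 : ℂ) • 1 := by
  split_ifs with h
  · rw [h, majorana_mul_self, two_smul]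
  · rw [majorana_anticomm_of_ne h, zero_smul]

/-! ### Parity, Majorana combinations and the commutator with H₀ -/

/-- The fermion parity operator. -/
def fermionParity (n : ℕ) : FockOp n := Matrix.diagonal fun x => ∏ i, occSign (x i)

theorem fermionParity_mul_self (n : ℕ) : fermionParity n * fermionParity n = 1 := by
  simp [fermionParity, Matrix.diagonal_mul_diagonal, prod_occSign_mul_self]

theorem fermionParity_mul_majorana {n : ℕ} (k : Fin (2 * n)) :
    fermionParity n * majorana k = -(majorana k * fermionParity n) := by
  ext y x
  rw [fermionParity, Matrix.diagonal_mul, Matrix.neg_apply, Matrix.mul_diagonal, majorana_apply]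
  split_ifs with h
  · rw [h, prod_occSign_occFlip]
    simp
    ring
  · simp

/-- The linear combination `∑ v_k ω_k` of Majorana operators. -/
def majoranaComb (n : ℕ) : (Fin (2 * n) → ℂ) →ₗ[ℂ] FockOp n :=
  Fintype.linearCombination ℂ majorana

theorem majoranaComb_apply {n : ℕ} (v : Fin (2 * n) → ℂ) :
    majoranaComb n v = ∑ k, v k • majorana k := rfl

theorem majoranaComb_anticomm {n : ℕ} (u v : Fin (2 * n) → ℂ) :
    majoranaComb n u * majoranaComb n v + majoranaComb n v * majoranaComb n u =
      (2 * (u ⬝ᵥ v)) • 1 := by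
  have h1 : majoranaComb n u * majoranaComb n v + majoranaComb n v * majoranaComb n u =
      ∑ k, ∑ l, (u k * v l) • (majorana k * majorana l + majorana l * majorana k) := by
    simp only [majoranaComb_apply, Finset.sum_mul_sum, smul_add, Finset.sum_add_distrib,
      smul_mul_smul_comm]
    congr 1
    rw [Finset.sum_comm]
    simp only [mul_comm]
  rw [h1]
  simp only [majorana_anticomm, smul_smul, ← Finset.sum_smul, dotProduct, mul_ite, mul_zero,
    Finset.sum_ite_eq, Finset.mem_univ, if_true, Finset.mul_sum]
  congr 1
  exact Finset.sum_congr rfl fun _ _ => by ring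

theorem fermionParity_mul_majoranaComb {n : ℕ} (v : Fin (2 * n) → ℂ) :
    fermionParity n * majoranaComb n v = -(majoranaComb n v * fermionParity n) := by
  simp [majoranaComb_apply, Finset.mul_sum, Finset.sum_mul, fermionParity_mul_majorana]

theorem majoranaComb_conjTranspose {n : ℕ} (v : Fin (2 * n) → ℂ) :
    (majoranaComb n v)ᴴ = majoranaComb n (star v) := by
  simp [majoranaComb_apply, Matrix.conjTranspose_sum, (majorana_isHermitian _).eq]

theorem majorana_eq_majoranaComb {n : ℕ} (k : Fin (2 * n)) :
    majorana k = majoranaComb n (Pi.single k 1) := by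
  simp [majoranaComb, Fintype.linearCombination_apply_single]

theorem freeHamiltonian_commutator {n : ℕ} {h : Matrix (Fin (2 * n)) (Fin (2 * n)) ℂ}
    (hanti : hᵀ = -h) (v : Fin (2 * n) → ℂ) :
    freeHamiltonian h * majoranaComb n v - majoranaComb n v * freeHamiltonian h =
      (4 : ℂ) • majoranaComb n (h *ᵥ v) := by
  have hH : freeHamiltonian h = ∑ j, majoranaComb n (fun i => h i j) * majorana j := by
    rw [freeHamiltonian, Finset.sum_comm]
    simp only [majoranaComb_apply, Finset.sum_mul, smul_mul_assoc]
  have hrow : ∀ j, (fun i => h i j) ⬝ᵥ v = -(h *ᵥ v) j := fun j => by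
    have := congrFun (congrArg (fun A : Matrix _ _ ℂ => A *ᵥ v) hanti) j
    rwa [Matrix.neg_mulVec] at this
  -- Moving `v` through both factors leaves two contractions. Antisymmetry of `h` gives them the
  -- same sign, and each sums to 2 w(hv), whence the factor 4.
  have key : ∀ j, majoranaComb n (fun i => h i j) * majorana j * majoranaComb n v -
      majoranaComb n v * (majoranaComb n (fun i => h i j) * majorana j) =
      (2 * v j) • majoranaComb n (fun i => h i j) + (2 * (h *ᵥ v) j) • majorana j := fun j => by
    have h1 := majoranaComb_anticomm (fun i => h i j) v
    have h2 := majoranaComb_anticomm (Pi.single j 1) v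
    rw [← majorana_eq_majoranaComb, single_one_dotProduct] at h2
    rw [hrow] at h1
    have h3 : majorana j * majoranaComb n v =
        (2 * v j) • 1 - majoranaComb n v * majorana j := eq_sub_of_add_eq h2
    have h4 : majoranaComb n v * majoranaComb n (fun i => h i j) =
        (2 * -(h *ᵥ v) j) • 1 - majoranaComb n (fun i => h i j) * majoranaComb n v :=
      eq_sub_of_add_eq' h1
    rw [mul_assoc, h3, ← mul_assoc (majoranaComb n v), h4]
    simp only [mul_sub, sub_mul, Matrix.mul_smul, Matrix.smul_mul, mul_one, one_mul, mul_assoc,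
      mul_neg, neg_smul, neg_mul]
    abel
  have hcol : ∑ j, v j • majoranaComb n (fun i => h i j) = majoranaComb n (h *ᵥ v) := by
    simp only [← map_smul, ← map_sum]
    congr 1
    ext i
    simp [Matrix.mulVec, dotProduct, mul_comm]
  rw [hH, Finset.sum_mul, Finset.mul_sum, ← Finset.sum_sub_distrib,
    Finset.sum_congr rfl fun j _ => key j, Finset.sum_add_distrib]
  simp only [mul_smul, ← Finset.smul_sum, hcol, ← majoranaComb_apply]
  rw [← add_smul]
  norm_num

/-! ### Bohr components and the Gibbs exponential -/

section Bohr

variable {m : Type*} [Fintype m] [DecidableEq m] {H : Matrix m m ℂ} (hH : H.IsHermitian)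

theorem cfc_mul_cfc (f g : ℝ → ℝ) : hH.cfc f * hH.cfc g = hH.cfc fun x => f x * g x := by
  simp only [Matrix.IsHermitian.cfc, ← map_mul, Matrix.diagonal_mul_diagonal]
  congr 2
  ext i
  simp

theorem cfc_congr_eigenvalues {f g : ℝ → ℝ}
    (hfg : ∀ i, f (hH.eigenvalues i) = g (hH.eigenvalues i)) :
    hH.cfc f = hH.cfc g := by
  simp only [Matrix.IsHermitian.cfc]
  congr 2
  ext i
  simp [hfg]

theorem cfc_one_eq : hH.cfc (fun _ => 1) = 1 := by
  simp [Matrix.IsHermitian.cfc, Function.comp_def]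

theorem cfc_self_eq : hH.cfc (fun x => x) = H := by
  conv_rhs => rw [hH.spectral_theorem]
  rfl

theorem cfc_smul_eq (c : ℝ) (f : ℝ → ℝ) : hH.cfc (fun x => c * f x) = (c : ℂ) • hH.cfc f := by
  simp only [Matrix.IsHermitian.cfc, ← map_smul, ← Matrix.diagonal_smul]
  congr 2
  ext i
  simp

theorem cfc_sum_eq {κ : Type*} (s : Finset κ) (f : κ → ℝ → ℝ) :
    ∑ k ∈ s, hH.cfc (f k) = hH.cfc fun x => ∑ k ∈ s, f k x := by
  simp only [Matrix.IsHermitian.cfc, ← map_sum]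
  congr 1
  ext i j
  rw [Matrix.sum_apply]
  by_cases hij : i = j <;> simp [hij]

theorem sum_energyProj : ∑ E ∈ energies hH, energyProj hH E = 1 := by
  simp only [energyProj]
  rw [cfc_sum_eq, ← cfc_one_eq hH]
  refine cfc_congr_eigenvalues hH fun i => ?_
  simp [energies]

theorem energyProj_mul_self_left (E : ℝ) : H * energyProj hH E = (E : ℂ) • energyProj hH E := by
  conv_lhs => arg 1; rw [← cfc_self_eq hH]
  rw [energyProj, cfc_mul_cfc, ← cfc_smul_eq]
  refine cfc_congr_eigenvalues hH fun i => ?_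
  split_ifs with h
  · rw [h]
  · simp

theorem energyProj_mul_self_right (E : ℝ) : energyProj hH E * H = (E : ℂ) • energyProj hH E := by
  conv_lhs => arg 2; rw [← cfc_self_eq hH]
  rw [energyProj, cfc_mul_cfc, ← cfc_smul_eq]
  refine cfc_congr_eigenvalues hH fun i => ?_
  split_ifs with h
  · rw [h, mul_comm]
  · simp

theorem lindbladOp_eq_sum (f : ℝ → ℂ) (A : Matrix m m ℂ) :
    lindbladOp hH f A = ∑ p ∈ energies hH ×ˢ energies hH,
      f (p.1 - p.2) • (energyProj hH p.1 * A * energyProj hH p.2) := by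
  rw [lindbladOp, ← Finset.sum_fiberwise_of_maps_to (t := bohrFreqs hH)
    (g := fun p : ℝ × ℝ => p.1 - p.2) fun p hp => Finset.mem_image_of_mem _ hp]
  refine Finset.sum_congr rfl fun ν _ => ?_
  rw [bohrComponent, Finset.smul_sum]
  refine Finset.sum_congr rfl fun p hp => ?_
  rw [(Finset.mem_filter.1 hp).2]

theorem sum_energyProj_mul_mul (A : Matrix m m ℂ) :
    ∑ p ∈ energies hH ×ˢ energies hH, energyProj hH p.1 * A * energyProj hH p.2 = A := by
  rw [Finset.sum_product]
  simp only [← Finset.mul_sum, sum_energyProj, mul_one, ← Finset.sum_mul, one_mul]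

theorem lindbladOp_of_commutator {A : Matrix m m ℂ} {c : ℝ} (hA : H * A - A * H = (c : ℂ) • A)
    (f : ℝ → ℂ) : lindbladOp hH f A = f c • A := by
  rw [lindbladOp_eq_sum]
  conv_rhs => rw [← sum_energyProj_mul_mul hH A, Finset.smul_sum]
  refine Finset.sum_congr rfl fun p _ => ?_
  -- Compressing the commutator relation to a block shows that only blocks with E - E' = c survive.
  have h1 : ((p.1 - p.2 - c : ℝ) : ℂ) • (energyProj hH p.1 * A * energyProj hH p.2) = 0 := by
    have h2 := congrArg (fun B => energyProj hH p.1 * B * energyProj hH p.2) hA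
    simp only [mul_sub, sub_mul, mul_smul_comm, smul_mul_assoc] at h2
    rw [← mul_assoc, energyProj_mul_self_right, mul_assoc _ (A * H), mul_assoc A,
      energyProj_mul_self_left] at h2
    simp only [mul_smul_comm, smul_mul_assoc] at h2
    rw [← mul_assoc, ← sub_smul] at h2
    push_cast
    rw [sub_smul, h2, sub_self]
  rcases smul_eq_zero.1 h1 with h3 | h3
  · rw [Complex.ofReal_eq_zero, sub_eq_zero] at h3
    rw [h3]
  · rw [h3, smul_zero, smul_zero]

theorem lindbladOp_sum {κ : Type*} (s : Finset κ) (f : ℝ → ℂ) (A : κ → Matrix m m ℂ) :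
    lindbladOp hH f (∑ k ∈ s, A k) = ∑ k ∈ s, lindbladOp hH f (A k) := by
  simp only [lindbladOp_eq_sum, Finset.mul_sum, Finset.sum_mul, Finset.smul_sum]
  rw [Finset.sum_comm]

theorem lindbladOp_smul (f : ℝ → ℂ) (c : ℂ) (A : Matrix m m ℂ) :
    lindbladOp hH f (c • A) = c • lindbladOp hH f A := by
  simp only [lindbladOp_eq_sum, mul_smul_comm, smul_mul_assoc, Finset.smul_sum, smul_comm c]

/-- An operator that commutes with `H` lives at Bohr frequency 0, where tanh vanishes. -/
theorem coherentTerm_eq_zero {ι : Type*} [Fintype ι] (β : ℝ) (f : ι → ℝ → ℂ)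
    (A : ι → Matrix m m ℂ)
    (h : Commute H (∑ a, (lindbladOp hH (f a) (A a))ᴴ * lindbladOp hH (f a) (A a))) :
    coherentTerm hH β f A = 0 := by
  have h1 : coherentTerm hH β f A = (Complex.I / 2) • lindbladOp hH
      (fun ν => ((Real.tanh (β * ν / 4) : ℝ) : ℂ))
      (∑ a, (lindbladOp hH (f a) (A a))ᴴ * lindbladOp hH (f a) (A a)) := by
    rw [lindbladOp_sum]
    rfl
  rw [h1, lindbladOp_of_commutator hH (c := 0) (by simp [h.eq])]
  simp

theorem exp_smul_mul_of_commutator {A : Matrix m m ℂ} {c : ℂ} (hA : H * A - A * H = c • A)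
    (s : ℂ) : NormedSpace.exp (s • H) * A =
      Complex.exp (s * c) • (A * NormedSpace.exp (s • H)) := by
  -- `A` intertwines a scalar shift of `s • H` with `s • H`, and intertwining passes to
  -- exponentials.
  have h1 : SemiconjBy A ((s * c) • 1 + s • H) (s • H) := by
    rw [SemiconjBy, mul_add, mul_smul_comm, mul_smul_comm, mul_one, mul_smul, ← hA, smul_mul_assoc,
      smul_sub, sub_add_cancel]
  have h2 : SemiconjBy A (NormedSpace.exp ((s * c) • 1 + s • H)) (NormedSpace.exp (s • H)) := by
    let _ : NormedRing (Matrix m m ℂ) := Matrix.linftyOpNormedRing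
    let _ : NormedAlgebra ℂ (Matrix m m ℂ) := Matrix.linftyOpNormedAlgebra
    let _ : NormedAlgebra ℚ (Matrix m m ℂ) := NormedAlgebra.restrictScalars ℚ ℂ _
    exact h1.exp_right
  have h3 : NormedSpace.exp ((s * c) • (1 : Matrix m m ℂ)) = Complex.exp (s * c) • 1 := by
    rw [← Matrix.diagonal_one, ← Matrix.diagonal_smul, Matrix.exp_diagonal, ← Matrix.diagonal_smul]
    congr 1
    ext i
    simp [Pi.coe_exp, Complex.exp_eq_exp_ℂ]
  rw [← h2.eq, Matrix.exp_add_of_commute _ _ ((Commute.one_left _).smul_left _), h3, smul_mul_assoc,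
    one_mul, mul_smul_comm]

theorem posDef_exp_smul {H : Matrix m m ℂ} (hH : H.IsHermitian) (β : ℝ) :
    (NormedSpace.exp (-(β : ℂ) • H)).PosDef := by
  set B := NormedSpace.exp (-((β / 2 : ℝ) : ℂ) • H) with hB
  have hBB : NormedSpace.exp (-(β : ℂ) • H) = Bᴴ * B := by
    have hBH : B.IsHermitian := Matrix.IsHermitian.exp (by
      rw [Matrix.IsHermitian, Matrix.conjTranspose_smul, hH.eq]
      simp)
    rw [hBH.eq, hB, ← Matrix.exp_add_of_commute _ _ (Commute.refl _), ← add_smul]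
    congr 2
    push_cast
    ring
  have hU : IsUnit (NormedSpace.exp (-(β : ℂ) • H)) := Matrix.isUnit_exp _
  rw [hBB] at hU ⊢
  exact (Matrix.posSemidef_conjTranspose_mul_self B).posDef_iff_isUnit.2 hU

theorem gibbsState_isDensityMatrix [Nonempty m] {H : Matrix m m ℂ} (hH : H.IsHermitian) (β : ℝ) :
    IsDensityMatrix (gibbsState β H) := by
  have h1 := posDef_exp_smul hH β
  have h2 := h1.trace_pos
  refine ⟨?_, ?_⟩
  · exact h1.posSemidef.smul (inv_nonneg.2 h2.le)
  · rw [gibbsState, Matrix.trace_smul, smul_eq_mul, inv_mul_cancel₀ h2.ne']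

end Bohr

/-! ### Occupation bases for canonical anticommutation relations -/

section CAR

variable {V : Type*} [AddCommGroup V] [Module ℂ V]

/-- Joint eigenvectors of the occupation operators `A_i D_i`, with prescribed occupation numbers,
of a (not necessarily self-adjoint) representation of the canonical anticommutation relations. -/
theorem exists_occupation_eigenvector [Nontrivial V] {m : ℕ} {A D : Fin m → Module.End ℂ V}
    (hA : ∀ i j, A i * A j + A j * A i = 0) (hD : ∀ i j, D i * D j + D j * D i = 0)
    (hAD : ∀ i j, A i * D j + D j * A i = if i = j then 1 else 0) (x : Fin m → Fin 2)
    (s : Finset (Fin m)) :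
    ∃ v : V, v ≠ 0 ∧ ∀ i ∈ s, (A i * D i) v = ((x i : ℕ) : ℂ) • v := by
  classical
  have hA2 : ∀ i, A i * A i = 0 := fun i => by
    have := hA i i
    rwa [← two_smul ℂ, smul_eq_zero_iff_right two_ne_zero] at this
  have hD2 : ∀ i, D i * D i = 0 := fun i => by
    have := hD i i
    rwa [← two_smul ℂ, smul_eq_zero_iff_right two_ne_zero] at this
  -- Two sign changes cancel, so adjusting mode `j` preserves the occupations already fixed.
  have hNA : ∀ i j, i ≠ j → A i * D i * A j = A j * (A i * D i) := fun i j hij => by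
    have h1 := hAD j i
    rw [if_neg (Ne.symm hij)] at h1
    rw [mul_assoc, eq_neg_of_add_eq_zero_right h1, mul_neg, ← mul_assoc,
      eq_neg_of_add_eq_zero_left (hA i j), neg_mul, neg_neg, mul_assoc]
  have hND : ∀ i j, i ≠ j → A i * D i * D j = D j * (A i * D i) := fun i j hij => by
    have h1 := hAD i j
    rw [if_neg hij] at h1
    rw [mul_assoc, eq_neg_of_add_eq_zero_left (hD i j), mul_neg, ← mul_assoc,
      eq_neg_of_add_eq_zero_left h1, neg_mul, neg_neg, mul_assoc]
  induction s using Finset.induction_on with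
  | empty =>
    obtain ⟨v, hv⟩ := exists_ne (0 : V)
    exact ⟨v, hv, by simp⟩
  | insert j s hj ih =>
    obtain ⟨v, hv, hvs⟩ := ih
    have hne : ∀ i ∈ s, i ≠ j := fun i hi => by rintro rfl; exact hj hi
    have hjj : A j * D j + D j * A j = 1 := by simpa using hAD j j
    have hx : x j = 0 ∨ x j = 1 := by
      generalize x j = b
      fin_cases b <;> simp
    rcases hx with hx | hx
    -- Either `D j` kills `v`, which is then empty at `j`, or `D j v` is a nonzero vector empty at
    -- `j` since D² = 0. The occupied case is the same with `A`.
    · by_cases hDv : D j v = 0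
      · refine ⟨v, hv, fun i hi => ?_⟩
        rcases Finset.mem_insert.1 hi with rfl | hi
        · simp [hx, hDv]
        · exact hvs i hi
      · refine ⟨D j v, hDv, fun i hi => ?_⟩
        rcases Finset.mem_insert.1 hi with rfl | hi
        · rw [← Module.End.mul_apply, mul_assoc, hD2]
          simp [hx]
        · rw [← Module.End.mul_apply, hND i j (hne i hi), Module.End.mul_apply, hvs i hi, map_smul]
    · by_cases hAv : A j v = 0
      · refine ⟨v, hv, fun i hi => ?_⟩
        rcases Finset.mem_insert.1 hi with rfl | hi
        · rw [eq_sub_of_add_eq hjj]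
          simp [hx, hAv]
        · exact hvs i hi
      · refine ⟨A j v, hAv, fun i hi => ?_⟩
        rcases Finset.mem_insert.1 hi with rfl | hi
        · rw [← Module.End.mul_apply, mul_assoc, eq_sub_of_add_eq' hjj, mul_sub, ← mul_assoc, hA2]
          simp [hx]
        · rw [← Module.End.mul_apply, hNA i j (hne i hi), Module.End.mul_apply, hvs i hi, map_smul]

/-- A representation of the canonical anticommutation relations with `m` modes on a space of
dimension `2 ^ m` has a basis of joint eigenvectors of the occupation operators. -/
theorem exists_occupation_basis [FiniteDimensional ℂ V] {m : ℕ} {A D : Fin m → Module.End ℂ V}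
    (hA : ∀ i j, A i * A j + A j * A i = 0) (hD : ∀ i j, D i * D j + D j * D i = 0)
    (hAD : ∀ i j, A i * D j + D j * A i = if i = j then 1 else 0)
    (hdim : Module.finrank ℂ V = 2 ^ m) :
    ∃ b : Module.Basis (Fin m → Fin 2) ℂ V,
      ∀ x i, (A i * D i) (b x) = ((x i : ℕ) : ℂ) • b x := by
  have : Nontrivial V := Module.nontrivial_of_finrank_pos (R := ℂ) (by rw [hdim]; positivity)
  choose b hb0 hb using fun x => exists_occupation_eigenvector hA hD hAD x Finset.univ
  have hlin : LinearIndependent ℂ b := by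
    -- Weighting the occupation operators by powers of 2 gives one operator whose eigenvalue at `x`
    -- is the number with binary digits `x`, so distinct strings have distinct eigenvalues.
    refine Module.End.eigenvectors_linearIndependent'
      (∑ i : Fin m, (2 ^ (i : ℕ) : ℂ) • (A i * D i) : Module.End ℂ V)
      (fun x => ((finFunctionFinEquiv x : ℕ) : ℂ)) ?_ b fun x => ?_
    · exact (Nat.cast_injective.comp Fin.val_injective).comp finFunctionFinEquiv.injective
    · refine ⟨Module.End.mem_eigenspace_iff.2 ?_, hb0 x⟩
      simp [LinearMap.sum_apply, hb, smul_smul, finFunctionFinEquiv, Finset.sum_smul, mul_comm]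
  exact ⟨basisOfLinearIndependentOfCardEqFinrank hlin (by simp [hdim]), fun x i => by
    simpa using hb x i (Finset.mem_univ i)⟩

theorem eigenvalueMultiset_of_basis [FiniteDimensional ℂ V] {κ : Type*} [Fintype κ]
    [DecidableEq κ] {T : Module.End ℂ V} (b : Module.Basis κ ℂ V) {μ : κ → ℂ}
    (h : ∀ x, T (b x) = μ x • b x) :
    eigenvalueMultiset T = Finset.univ.val.map μ := by
  have hM : LinearMap.toMatrix b b T = Matrix.diagonal μ := by
    ext x y
    rw [LinearMap.toMatrix_apply, h]
    by_cases hxy : x = y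
    · simp [hxy]
    · simp [hxy]
  rw [eigenvalueMultiset, ← LinearMap.charpoly_toMatrix T b, hM, Matrix.charpoly_diagonal]
  have := Polynomial.roots_multiset_prod_X_sub_C (Finset.univ.val.map μ)
  rwa [Multiset.map_map] at this

/-- The kernel lies in the line of `b x₀`, and the nonzero kernel vector `σ` spans that line. -/
theorem ker_eq_span_of_basis {κ : Type*} {T : Module.End ℂ V} (b : Module.Basis κ ℂ V)
    {μ : κ → ℂ} (h : ∀ x, T (b x) = μ x • b x) {x₀ : κ} (hx₀ : ∀ x, x ≠ x₀ → μ x ≠ 0)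
    {σ : V} (hσ : T σ = 0) (hσ0 : σ ≠ 0) : LinearMap.ker T = Submodule.span ℂ {σ} := by
  have hrepr : ∀ v, T v = 0 → v = b.repr v x₀ • b x₀ := fun v hv => by
    have hcoord : ∀ x w, b.repr (T w) x = μ x * b.repr w x := fun x w => by
      have : (Finsupp.lapply x ∘ₗ b.repr.toLinearMap) ∘ₗ T =
          μ x • (Finsupp.lapply x ∘ₗ b.repr.toLinearMap) := b.ext fun y => by
        by_cases hxy : y = x <;> simp [h, hxy]
      exact LinearMap.congr_fun this w
    apply b.repr.injective
    ext x
    by_cases hx : x = x₀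
    · simp [hx]
    · have := hcoord x v
      rw [hv, map_zero, Finsupp.zero_apply, eq_comm, mul_eq_zero, or_iff_right (hx₀ x hx)] at this
      simp [this, Ne.symm hx]
  apply le_antisymm
  · intro v hv
    have hσ1 := hrepr σ hσ
    have hc : b.repr σ x₀ ≠ 0 := fun hc => hσ0 (by rw [hσ1, hc, zero_smul])
    refine Submodule.mem_span_singleton.2 ⟨b.repr v x₀ / b.repr σ x₀, ?_⟩
    conv_rhs => rw [hrepr v hv]
    conv_lhs => rw [hσ1]
    rw [smul_smul]
    simp [hc]
  · rw [Submodule.span_singleton_le_iff_mem]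
    exact hσ

end CAR

section Gaps

theorem sort_cons_cons {α : Type*} (r : α → α → Prop) [DecidableRel r] [IsTrans α r]
    [Std.Antisymm r] [Std.Total r] {a b : α} {t : Multiset α} (hab : r a b) (hb : ∀ c ∈ t, r b c) :
    (a ::ₘ b ::ₘ t).sort r = a :: b :: t.sort r := by
  rw [Multiset.sort_cons, Multiset.sort_cons]
  · exact hb
  · intro c hc
    rcases Multiset.mem_cons.1 hc with rfl | hc
    · exact hab
    · exact _root_.trans hab (hb c hc)

end Gaps

/-! ### Eigenvectors of an antisymmetric Hermitian matrix -/

section Eigenvectors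

variable {m : Type*} [Fintype m] [DecidableEq m] {h : Matrix m m ℂ} (hh : h.IsHermitian)

/-- The `i`-th eigenvector of a Hermitian matrix, as a plain vector. -/
noncomputable def eigvec (i : m) : m → ℂ := fun k => (hh.eigenvectorUnitary : Matrix m m ℂ) k i

theorem mulVec_eigvec (i : m) : h *ᵥ eigvec hh i = (hh.eigenvalues i : ℂ) • eigvec hh i := by
  have h1 : eigvec hh i = (hh.eigenvectorBasis i).ofLp := rfl
  rw [h1, hh.mulVec_eigenvectorBasis i]
  rfl

theorem star_eigvec_dotProduct (i j : m) :
    star (eigvec hh i) ⬝ᵥ eigvec hh j = if i = j then 1 else 0 := by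
  have := congrFun (congrFun (Unitary.coe_star_mul_self hh.eigenvectorUnitary) i) j
  rwa [Matrix.mul_apply, Matrix.one_apply] at this

theorem sum_star_eigvec_smul (u : m → ℂ) : ∑ i, (star (eigvec hh i) ⬝ᵥ u) • eigvec hh i = u := by
  have h1 := congrArg (fun A : Matrix m m ℂ => A *ᵥ u)
    (Unitary.coe_mul_star_self hh.eigenvectorUnitary)
  simp only [Matrix.one_mulVec, ← Matrix.mulVec_mulVec] at h1
  conv_rhs => rw [← h1]
  ext k
  simp only [Finset.sum_apply, Pi.smul_apply, smul_eq_mul, mul_comm]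
  rfl

theorem add_eigenvalues_mul_dotProduct (hanti : hᵀ = -h) (i j : m) :
    ((hh.eigenvalues i : ℂ) + hh.eigenvalues j) * (eigvec hh i ⬝ᵥ eigvec hh j) = 0 := by
  have h1 : (h *ᵥ eigvec hh i) ⬝ᵥ eigvec hh j = -(eigvec hh i ⬝ᵥ (h *ᵥ eigvec hh j)) := by
    rw [Matrix.dotProduct_mulVec, ← Matrix.mulVec_transpose, hanti, Matrix.neg_mulVec,
      neg_dotProduct, neg_neg]
  rw [mulVec_eigvec, mulVec_eigvec, smul_dotProduct, dotProduct_smul, smul_eq_mul,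
    smul_eq_mul] at h1
  rw [add_mul, h1, neg_add_cancel]

/-- Either the bilinear pairing vanishes or ε_i = -ε_j. This replaces an explicit pairing of
eigenvectors with their conjugates, so degenerate eigenvalues need no special care. -/
theorem mul_star_dotProduct (hanti : hᵀ = -h) (φ : ℝ → ℂ) (i j : m) :
    φ (hh.eigenvalues i) * (star (eigvec hh i) ⬝ᵥ star (eigvec hh j)) =
      φ (-hh.eigenvalues j) * (star (eigvec hh i) ⬝ᵥ star (eigvec hh j)) := by
  rcases mul_eq_zero.1 (add_eigenvalues_mul_dotProduct hh hanti j i) with h1 | h1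
  · have h2 : hh.eigenvalues i = -hh.eigenvalues j := by
      rw [← Complex.ofReal_add, Complex.ofReal_eq_zero] at h1
      linarith
    rw [h2]
  · rw [Matrix.star_dotProduct_star, h1, star_zero, mul_zero, mul_zero]

/-- Complex conjugation maps the eigenvectors of an antisymmetric Hermitian matrix to eigenvectors
with the opposite eigenvalue. -/
theorem sum_bilin_star_eigvec (hanti : hᵀ = -h) {M : Type*} [AddCommGroup M] [Module ℂ M]
    (B : (m → ℂ) →ₗ[ℂ] (m → ℂ) →ₗ[ℂ] M) (φ : ℝ → ℂ) :
    ∑ i, φ (hh.eigenvalues i) • B (star (eigvec hh i)) (eigvec hh i) =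
      ∑ i, φ (-hh.eigenvalues i) • B (eigvec hh i) (star (eigvec hh i)) := by
  -- Expanding the conjugate vectors in the eigenbasis turns both sides into double sums over the
  -- same terms, up to the argument of `φ`.
  have h1 : ∀ i, φ (hh.eigenvalues i) • B (star (eigvec hh i)) (eigvec hh i) =
      ∑ j, (φ (hh.eigenvalues i) * (star (eigvec hh i) ⬝ᵥ star (eigvec hh j))) •
        B (eigvec hh j) (eigvec hh i) := fun i => by
    conv_lhs => rw [← sum_star_eigvec_smul hh (star (eigvec hh i))]
    simp only [map_sum, map_smul, LinearMap.sum_apply, LinearMap.smul_apply, Finset.smul_sum,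
      smul_smul]
    exact Finset.sum_congr rfl fun j _ => by rw [dotProduct_comm]
  have h2 : ∀ j, φ (-hh.eigenvalues j) • B (eigvec hh j) (star (eigvec hh j)) =
      ∑ i, (φ (-hh.eigenvalues j) * (star (eigvec hh i) ⬝ᵥ star (eigvec hh j))) •
        B (eigvec hh j) (eigvec hh i) := fun j => by
    conv_lhs => rw [← sum_star_eigvec_smul hh (star (eigvec hh j))]
    simp only [map_sum, map_smul, Finset.smul_sum, smul_smul]
  simp only [h1, h2]
  rw [Finset.sum_comm]
  exact Finset.sum_congr rfl fun j _ => Finset.sum_congr rfl fun i _ => by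
    rw [mul_star_dotProduct hh hanti]

end Eigenvectors

/-! ### Reduction to eigenmode dissipators; detailed balance -/

section Generator

variable {n : ℕ} {h : Matrix (Fin (2 * n)) (Fin (2 * n)) ℂ} (hh : h.IsHermitian)

/-- The eigenmode `∑ v_k ω_k` of `H₀`, where `v` is the `i`-th eigenvector of `h`. -/
noncomputable def eigenmode (i : Fin (2 * n)) : FockOp n := majoranaComb n (eigvec hh i)

theorem eigenmode_commutator (hanti : hᵀ = -h) (i : Fin (2 * n)) :
    freeHamiltonian h * eigenmode hh i - eigenmode hh i * freeHamiltonian h =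
      ((4 * hh.eigenvalues i : ℝ) : ℂ) • eigenmode hh i := by
  rw [eigenmode, freeHamiltonian_commutator hanti, mulVec_eigvec, map_smul, smul_smul]
  push_cast
  rfl

/-- The mode shifts the energy by 4ε and its adjoint shifts it back. -/
theorem commute_eigenmode (hanti : hᵀ = -h) (i : Fin (2 * n)) :
    Commute (freeHamiltonian h) ((eigenmode hh i)ᴴ * eigenmode hh i) := by
  have h1 := eigenmode_commutator hh hanti i
  have h2 := congrArg Matrix.conjTranspose h1
  rw [Matrix.conjTranspose_sub, Matrix.conjTranspose_mul, Matrix.conjTranspose_mul,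
    Matrix.conjTranspose_smul, (freeHamiltonian_isHermitian hh).eq] at h2
  simp only [RCLike.star_def, Complex.conj_ofReal] at h2
  have h3 : (eigenmode hh i)ᴴ * (freeHamiltonian h * eigenmode hh i -
      eigenmode hh i * freeHamiltonian h) = ((eigenmode hh i)ᴴ * freeHamiltonian h -
      freeHamiltonian h * (eigenmode hh i)ᴴ) * eigenmode hh i := by
    rw [h1, h2, mul_smul_comm, smul_mul_assoc]
  rw [mul_sub, sub_mul, ← mul_assoc, sub_right_inj] at h3
  rw [Commute, SemiconjBy, ← mul_assoc, ← h3, mul_assoc]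

theorem majorana_eq_sum_eigenmode (a : Fin (2 * n)) :
    majorana a = ∑ i, star (eigvec hh i a) • eigenmode hh i := by
  rw [majorana_eq_majoranaComb, ← sum_star_eigvec_smul hh (Pi.single a 1), map_sum]
  simp [eigenmode]

theorem lindbladOp_majorana (hanti : hᵀ = -h) (f : ℝ → ℂ) (a : Fin (2 * n)) :
    lindbladOp (freeHamiltonian_isHermitian hh) f (majorana a) =
      ∑ i, (star (eigvec hh i a) * f (4 * hh.eigenvalues i)) • eigenmode hh i := by
  rw [majorana_eq_sum_eigenmode hh a, lindbladOp_sum]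
  simp only [lindbladOp_smul, lindbladOp_of_commutator _ (eigenmode_commutator hh hanti _),
    smul_smul]

/-- Orthonormality of the eigenvectors removes the cross terms i ≠ j after summing over `a`. A
general `B` covers both ∑ L_a†L_a and the dissipator. -/
theorem sum_bilin_lindbladOp (hanti : hᵀ = -h) (f : ℝ → ℝ) {M : Type*} [AddCommGroup M]
    [Module ℂ M] (B : FockOp n →ₗ[ℂ] FockOp n →ₗ[ℂ] M) :
    ∑ a, B (lindbladOp (freeHamiltonian_isHermitian hh) (fun ν => (f ν : ℂ)) (majorana a))
        (lindbladOp (freeHamiltonian_isHermitian hh) (fun ν => (f ν : ℂ)) (majorana a))ᴴ =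
      ∑ i, ((f (4 * hh.eigenvalues i) ^ 2 : ℝ) : ℂ) •
        B (eigenmode hh i) (eigenmode hh i)ᴴ := by
  have h1 : ∀ a, B (lindbladOp (freeHamiltonian_isHermitian hh) (fun ν => (f ν : ℂ)) (majorana a))
      (lindbladOp (freeHamiltonian_isHermitian hh) (fun ν => (f ν : ℂ)) (majorana a))ᴴ =
      ∑ i, ∑ j, ((star (eigvec hh i) a * eigvec hh j a) * (f (4 * hh.eigenvalues i) *
        f (4 * hh.eigenvalues j) : ℂ)) • B (eigenmode hh i) (eigenmode hh j)ᴴ := fun a => by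
    rw [lindbladOp_majorana hh hanti]
    simp only [Matrix.conjTranspose_sum, Matrix.conjTranspose_smul, map_sum, map_smul,
      LinearMap.sum_apply, LinearMap.smul_apply, Finset.smul_sum, smul_smul]
    rw [Finset.sum_comm]
    refine Finset.sum_congr rfl fun i _ => Finset.sum_congr rfl fun j _ => ?_
    congr 1
    simp
    ring
  simp only [h1]
  rw [Finset.sum_comm]
  refine Finset.sum_congr rfl fun i _ => ?_
  rw [Finset.sum_comm]
  have h2 : ∀ j, ∑ a, ((star (eigvec hh i) a * eigvec hh j a) * (f (4 * hh.eigenvalues i) *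
        f (4 * hh.eigenvalues j) : ℂ)) • B (eigenmode hh i) (eigenmode hh j)ᴴ =
      if i = j then ((f (4 * hh.eigenvalues i) ^ 2 : ℝ) : ℂ) •
        B (eigenmode hh i) (eigenmode hh i)ᴴ else 0 := fun j => by
    rw [← Finset.sum_smul, ← Finset.sum_mul, ← dotProduct, star_eigvec_dotProduct]
    split_ifs with hij
    · subst hij
      push_cast
      rw [one_mul, sq]
    · rw [zero_mul, zero_smul]
  simp only [h2, Finset.sum_ite_eq, Finset.mem_univ, if_true]

/-- The dissipator `X ↦ Y X Z - (1/2) {Z Y, X}`, bilinear in `(Y, Z)`. -/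
noncomputable def dissipator {m : Type*} [Fintype m] [DecidableEq m] (X : Matrix m m ℂ) :
    Matrix m m ℂ →ₗ[ℂ] Matrix m m ℂ →ₗ[ℂ] Matrix m m ℂ :=
  LinearMap.mk₂ ℂ (fun Y Z => Y * X * Z - (1 / 2 : ℂ) • (Z * Y * X + X * (Z * Y)))
    (fun _ _ _ => by simp only [add_mul, mul_add]; module)
    (fun _ _ _ => by simp only [smul_mul_assoc, mul_smul_comm]; module)
    (fun _ _ _ => by simp only [add_mul, mul_add]; module)
    (fun _ _ _ => by simp only [smul_mul_assoc, mul_smul_comm]; module)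

theorem dissipator_apply {m : Type*} [Fintype m] [DecidableEq m] (X Y Z : Matrix m m ℂ) :
    dissipator X Y Z = Y * X * Z - (1 / 2 : ℂ) • (Z * Y * X + X * (Z * Y)) := rfl

/-- The rate `q(4x)² e^{-2βx}` of the eigenmode with single-particle energy `x`. -/
noncomputable def modeRate (β : ℝ) (q : ℝ → ℝ) (x : ℝ) : ℂ :=
  ((q (4 * x) ^ 2 * Real.exp (-2 * β * x) : ℝ) : ℂ)

theorem freeLindbladian_eq_sum_dissipator (hanti : hᵀ = -h) (β : ℝ) (q : ℝ → ℝ) (X : FockOp n) :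
    freeLindbladian hh β q X = ∑ i, modeRate β q (hh.eigenvalues i) •
      dissipator X (eigenmode hh i) (eigenmode hh i)ᴴ := by
  have hcomm : Commute (freeHamiltonian h) (∑ a, (lindbladOp (freeHamiltonian_isHermitian hh)
      (fun ν => ((q ν * Real.exp (-β * ν / 4) : ℝ) : ℂ)) (majorana a))ᴴ *
      lindbladOp (freeHamiltonian_isHermitian hh)
      (fun ν => ((q ν * Real.exp (-β * ν / 4) : ℝ) : ℂ)) (majorana a)) := by
    have := sum_bilin_lindbladOp hh hanti (fun ν => q ν * Real.exp (-β * ν / 4))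
      (LinearMap.mul ℂ (FockOp n)).flip
    simp only [LinearMap.flip_apply, LinearMap.mul_apply'] at this
    rw [this]
    exact Commute.sum_right _ _ _ fun i _ => (commute_eigenmode hh hanti i).smul_right _
  have h1 : freeLindbladian hh β q X = ∑ a, dissipator X
      (lindbladOp (freeHamiltonian_isHermitian hh)
        (fun ν => ((q ν * Real.exp (-β * ν / 4) : ℝ) : ℂ)) (majorana a))
      (lindbladOp (freeHamiltonian_isHermitian hh)
        (fun ν => ((q ν * Real.exp (-β * ν / 4) : ℝ) : ℂ)) (majorana a))ᴴ := by
    unfold freeLindbladian gibbsLindbladian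
    rw [coherentTerm_eq_zero _ _ _ _ hcomm]
    simp [lindbladGenerator, dissipator_apply]
  rw [h1, sum_bilin_lindbladOp hh hanti (fun ν => q ν * Real.exp (-β * ν / 4))]
  refine Finset.sum_congr rfl fun i _ => ?_
  congr 2
  rw [mul_pow, ← Real.exp_nat_mul]
  congr 2
  push_cast
  ring

/-- Detailed balance: moving `ρ` to the left of a mode costs e^{4βε}, which turns the rate at ε into
the rate at -ε. Gain and loss then cancel in the sum, by conjugation symmetry of the eigenmodes. -/
theorem freeLindbladian_exp (hanti : hᵀ = -h) (β : ℝ) {q : ℝ → ℝ} (hq : ∀ ν, q (-ν) = q ν) :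
    freeLindbladian hh β q (NormedSpace.exp (-(β : ℂ) • freeHamiltonian h)) = 0 := by
  set ρ := NormedSpace.exp (-(β : ℂ) • freeHamiltonian h) with hρ
  have h1 : ∀ i, modeRate β q (hh.eigenvalues i) •
      dissipator ρ (eigenmode hh i) (eigenmode hh i)ᴴ =
      ρ * (modeRate β q (-hh.eigenvalues i) • (eigenmode hh i * (eigenmode hh i)ᴴ) -
        modeRate β q (hh.eigenvalues i) • ((eigenmode hh i)ᴴ * eigenmode hh i)) := fun i => by
    have h2 := exp_smul_mul_of_commutator (eigenmode_commutator hh hanti i) (-(β : ℂ))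
    have h3 := exp_smul_mul_of_commutator (c := 0)
      (by rw [(commute_eigenmode hh hanti i).eq, sub_self, zero_smul]) (-(β : ℂ))
    rw [mul_zero, Complex.exp_zero, one_smul, ← hρ] at h3
    have h4 : eigenmode hh i * ρ = Complex.exp (4 * β * hh.eigenvalues i) •
        (ρ * eigenmode hh i) := by
      rw [hρ, h2, smul_smul, ← Complex.exp_add]
      have : (4 * β * hh.eigenvalues i : ℂ) + -β * ((4 * hh.eigenvalues i : ℝ) : ℂ) = 0 := by
        push_cast
        ring
      rw [this, Complex.exp_zero, one_smul]
    have h5 : modeRate β q (-hh.eigenvalues i) =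
        modeRate β q (hh.eigenvalues i) * Complex.exp (4 * β * hh.eigenvalues i) := by
      simp only [modeRate]
      rw [mul_neg, hq]
      push_cast
      rw [mul_assoc (_ ^ 2), ← Complex.exp_add]
      congr 2
      ring
    rw [dissipator_apply, ← h3, ← two_smul ℂ, smul_smul, h4, h5, mul_sub, smul_sub, mul_smul_comm,
      mul_smul_comm, smul_mul_assoc, smul_smul, mul_assoc ρ]
    norm_num
  rw [freeLindbladian_eq_sum_dissipator hh hanti, Finset.sum_congr rfl fun i _ => h1 i,
    ← Finset.mul_sum, Finset.sum_sub_distrib]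
  have h6 := sum_bilin_star_eigvec hh hanti
    ((LinearMap.mul ℂ (FockOp n)).compl₁₂ (majoranaComb n) (majoranaComb n)) (modeRate β q)
  simp only [LinearMap.compl₁₂_apply, LinearMap.mul_apply', ← majoranaComb_conjTranspose] at h6
  simp only [eigenmode, h6, sub_self, mul_zero]

end Generator

/-! ### Third quantization -/

section Quantization

variable {n : ℕ}

/-- The superoperator `X ↦ w(v) X P`, where `P` is the fermion parity. -/
noncomputable def leftMajorana (n : ℕ) : (Fin (2 * n) → ℂ) →ₗ[ℂ] Module.End ℂ (FockOp n) :=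
  LinearMap.mk₂ ℂ (fun v X => majoranaComb n v * X * fermionParity n)
    (fun _ _ _ => by simp only [map_add, add_mul])
    (fun _ _ _ => by simp only [map_smul, smul_mul_assoc])
    (fun _ _ _ => by simp only [mul_add, add_mul])
    (fun _ _ _ => by simp only [mul_smul_comm, smul_mul_assoc])

/-- The superoperator `X ↦ X w(v) P`, where `P` is the fermion parity. -/
noncomputable def rightMajorana (n : ℕ) : (Fin (2 * n) → ℂ) →ₗ[ℂ] Module.End ℂ (FockOp n) :=
  LinearMap.mk₂ ℂ (fun v X => X * majoranaComb n v * fermionParity n)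
    (fun _ _ _ => by simp only [map_add, mul_add, add_mul])
    (fun _ _ _ => by simp only [map_smul, mul_smul_comm, smul_mul_assoc])
    (fun _ _ _ => by simp only [add_mul])
    (fun _ _ _ => by simp only [smul_mul_assoc])

theorem leftMajorana_apply (v : Fin (2 * n) → ℂ) (X : FockOp n) :
    leftMajorana n v X = majoranaComb n v * X * fermionParity n := rfl

theorem rightMajorana_apply (v : Fin (2 * n) → ℂ) (X : FockOp n) :
    rightMajorana n v X = X * majoranaComb n v * fermionParity n := rfl

theorem mul_fermionParity_mul_fermionParity (X : FockOp n) :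
    X * fermionParity n * fermionParity n = X := by
  rw [mul_assoc, fermionParity_mul_self, mul_one]

theorem mul_fermionParity_mul_majoranaComb (X : FockOp n) (v : Fin (2 * n) → ℂ) :
    X * fermionParity n * majoranaComb n v = -(X * majoranaComb n v * fermionParity n) := by
  rw [mul_assoc, fermionParity_mul_majoranaComb, mul_neg, mul_assoc]

theorem leftMajorana_mul_leftMajorana (u v : Fin (2 * n) → ℂ) (X : FockOp n) :
    (leftMajorana n u * leftMajorana n v) X = majoranaComb n u * majoranaComb n v * X := by
  simp only [Module.End.mul_apply, leftMajorana_apply, ← mul_assoc,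
    mul_fermionParity_mul_fermionParity]

theorem rightMajorana_mul_rightMajorana (u v : Fin (2 * n) → ℂ) (X : FockOp n) :
    (rightMajorana n u * rightMajorana n v) X =
      -(X * (majoranaComb n v * majoranaComb n u)) := by
  simp only [Module.End.mul_apply, rightMajorana_apply, mul_fermionParity_mul_majoranaComb,
    ← mul_assoc, neg_mul, mul_fermionParity_mul_fermionParity]

theorem leftMajorana_mul_rightMajorana (u v : Fin (2 * n) → ℂ) (X : FockOp n) :
    (leftMajorana n u * rightMajorana n v) X = majoranaComb n u * X * majoranaComb n v := by
  simp only [Module.End.mul_apply, leftMajorana_apply, rightMajorana_apply, ← mul_assoc,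
    mul_fermionParity_mul_fermionParity]

/-- Untwisted left and right multiplications commute; carrying the parity past a Majorana
combination supplies the sign. -/
theorem rightMajorana_mul_leftMajorana (u v : Fin (2 * n) → ℂ) :
    rightMajorana n v * leftMajorana n u = -(leftMajorana n u * rightMajorana n v) := by
  refine LinearMap.ext fun X => ?_
  rw [LinearMap.neg_apply, leftMajorana_mul_rightMajorana]
  simp only [Module.End.mul_apply, leftMajorana_apply, rightMajorana_apply,
    mul_fermionParity_mul_majoranaComb, neg_mul, mul_fermionParity_mul_fermionParity]

theorem leftMajorana_anticomm (u v : Fin (2 * n) → ℂ) :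
    leftMajorana n v * leftMajorana n u =
      (2 * (u ⬝ᵥ v)) • 1 - leftMajorana n u * leftMajorana n v := by
  refine LinearMap.ext fun X => ?_
  rw [LinearMap.sub_apply, leftMajorana_mul_leftMajorana, leftMajorana_mul_leftMajorana,
    eq_sub_of_add_eq' (majoranaComb_anticomm u v), sub_mul]
  simp

theorem rightMajorana_anticomm (u v : Fin (2 * n) → ℂ) :
    rightMajorana n v * rightMajorana n u =
      -(2 * (u ⬝ᵥ v)) • 1 - rightMajorana n u * rightMajorana n v := by
  refine LinearMap.ext fun X => ?_
  rw [LinearMap.sub_apply, rightMajorana_mul_rightMajorana, rightMajorana_mul_rightMajorana,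
    eq_sub_of_add_eq (majoranaComb_anticomm u v), mul_sub]
  simp [neg_add_eq_sub]

/-- The creation-type superoperator `l(v) + r(v)`. -/
noncomputable def superCreation (n : ℕ) : (Fin (2 * n) → ℂ) →ₗ[ℂ] Module.End ℂ (FockOp n) :=
  leftMajorana n + rightMajorana n

/-- The annihilation-type superoperator `l(v) - r(v)`. -/
noncomputable def superAnnihilation (n : ℕ) : (Fin (2 * n) → ℂ) →ₗ[ℂ] Module.End ℂ (FockOp n) :=
  leftMajorana n - rightMajorana n

/-- The anticommutators of l and of r are opposite scalars, so they cancel here and for l - r, and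
add up in the mixed relation. -/
theorem superCreation_anticomm (u v : Fin (2 * n) → ℂ) :
    superCreation n u * superCreation n v + superCreation n v * superCreation n u = 0 := by
  simp only [superCreation, LinearMap.add_apply, mul_add, add_mul, rightMajorana_mul_leftMajorana,
    leftMajorana_anticomm u v, rightMajorana_anticomm u v]
  module

theorem superAnnihilation_anticomm (u v : Fin (2 * n) → ℂ) :
    superAnnihilation n u * superAnnihilation n v +
      superAnnihilation n v * superAnnihilation n u = 0 := by
  simp only [superAnnihilation, LinearMap.sub_apply, mul_sub, sub_mul,
    rightMajorana_mul_leftMajorana, leftMajorana_anticomm u v, rightMajorana_anticomm u v]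
  module

theorem superCreation_superAnnihilation_anticomm (u v : Fin (2 * n) → ℂ) :
    superCreation n u * superAnnihilation n v + superAnnihilation n v * superCreation n u =
      (4 * (u ⬝ᵥ v)) • 1 := by
  simp only [superCreation, superAnnihilation, LinearMap.add_apply, LinearMap.sub_apply, mul_add,
    add_mul, mul_sub, sub_mul, rightMajorana_mul_leftMajorana, leftMajorana_anticomm u v,
    rightMajorana_anticomm u v]
  module

theorem dissipator_majoranaComb {u v : Fin (2 * n) → ℂ} (huv : u ⬝ᵥ v = 1) (X : FockOp n) :
    dissipator X (majoranaComb n u) (majoranaComb n v) =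
      ((1 / 2 : ℂ) • (superCreation n u * superCreation n v) -
        (1 / 4 : ℂ) • (superCreation n u * superAnnihilation n v +
          superCreation n v * superAnnihilation n u)) X := by
  -- The three terms of the dissipator are quadratic in l and r. Rewritten through l ± r, the
  -- scalars from reordering cancel.
  have h1 : dissipator X (majoranaComb n u) (majoranaComb n v) =
      (leftMajorana n u * rightMajorana n v - (1 / 2 : ℂ) • (leftMajorana n v * leftMajorana n u) +
        (1 / 2 : ℂ) • (rightMajorana n u * rightMajorana n v)) X := by
    simp only [LinearMap.add_apply, LinearMap.sub_apply, LinearMap.smul_apply,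
      leftMajorana_mul_rightMajorana, leftMajorana_mul_leftMajorana,
      rightMajorana_mul_rightMajorana, dissipator_apply]
    module
  rw [h1]
  congr 1
  simp only [superCreation, superAnnihilation, LinearMap.add_apply, LinearMap.sub_apply, mul_add,
    add_mul, mul_sub, rightMajorana_mul_leftMajorana, leftMajorana_anticomm u v,
    rightMajorana_anticomm u v, huv]
  module

end Quantization

/-! ### Normal modes and the eigenbasis -/

section Spectrum

variable {n : ℕ} {h : Matrix (Fin (2 * n)) (Fin (2 * n)) ℂ} (hh : h.IsHermitian)

/-- Minus half the eigenvalue of the Lindbladian that belongs to the mode of energy `x`. -/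
noncomputable def modeDecay (β : ℝ) (q : ℝ → ℝ) (x : ℝ) : ℝ :=
  q (4 * x) ^ 2 * Real.cosh (2 * β * x)

/-- The Bogoliubov coefficient `tanh (2βx)` of the mode with single-particle energy `x`. -/
noncomputable def modeTanh (β x : ℝ) : ℂ := ((Real.tanh (2 * β * x) : ℝ) : ℂ)

theorem modeTanh_neg (β x : ℝ) : modeTanh β (-x) = -modeTanh β x := by
  simp [modeTanh]

theorem modeRate_add_neg (β : ℝ) {q : ℝ → ℝ} (hq : ∀ ν, q (-ν) = q ν) (x : ℝ) :
    modeRate β q x + modeRate β q (-x) = 2 * (modeDecay β q x : ℂ) := by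
  simp only [modeRate, modeDecay, mul_neg, hq, Real.cosh_eq, neg_mul, neg_neg]
  push_cast
  ring

theorem modeRate_sub_neg (β : ℝ) {q : ℝ → ℝ} (hq : ∀ ν, q (-ν) = q ν) (x : ℝ) :
    modeRate β q x - modeRate β q (-x) =
      -(2 * modeTanh β x * (modeDecay β q x : ℂ)) := by
  have h1 : modeRate β q x - modeRate β q (-x) =
      ((-(2 * (q (4 * x) ^ 2 * Real.sinh (2 * β * x))) : ℝ) : ℂ) := by
    simp only [modeRate, mul_neg, hq, Real.sinh_eq, neg_mul, neg_neg]
    push_cast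
    ring
  rw [h1, modeTanh, modeDecay, Real.tanh_eq_sinh_div_cosh]
  have := (Real.cosh_pos (2 * β * x)).ne'
  norm_cast
  field_simp

/-- The normal-mode creation superoperators of the free Lindbladian. -/
noncomputable def normalCreation (i : Fin (2 * n)) : Module.End ℂ (FockOp n) :=
  (1 / 2 : ℂ) • superCreation n (eigvec hh i)

/-- The normal-mode annihilation superoperators of the free Lindbladian. -/
noncomputable def normalAnnihilation (β : ℝ) (i : Fin (2 * n)) : Module.End ℂ (FockOp n) :=
  (1 / 2 : ℂ) • (superAnnihilation n (star (eigvec hh i)) +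
    modeTanh β (hh.eigenvalues i) • superCreation n (star (eigvec hh i)))

theorem normalCreation_anticomm (i j : Fin (2 * n)) :
    normalCreation hh i * normalCreation hh j + normalCreation hh j * normalCreation hh i = 0 := by
  simp only [normalCreation, smul_mul_smul_comm, ← smul_add, superCreation_anticomm, smul_zero]

theorem normalCreation_normalAnnihilation_anticomm (β : ℝ) (i j : Fin (2 * n)) :
    normalCreation hh i * normalAnnihilation hh β j +
      normalAnnihilation hh β j * normalCreation hh i = if i = j then 1 else 0 := by
  have h1 : normalCreation hh i * normalAnnihilation hh β j +
      normalAnnihilation hh β j * normalCreation hh i = (1 / 4 : ℂ) •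
      ((superCreation n (eigvec hh i) * superAnnihilation n (star (eigvec hh j)) +
        superAnnihilation n (star (eigvec hh j)) * superCreation n (eigvec hh i)) +
      modeTanh β (hh.eigenvalues j) •
        (superCreation n (eigvec hh i) * superCreation n (star (eigvec hh j)) +
          superCreation n (star (eigvec hh j)) * superCreation n (eigvec hh i))) := by
    simp only [normalCreation, normalAnnihilation, mul_add, add_mul,
      smul_mul_assoc, mul_smul_comm]
    module
  rw [h1, superCreation_superAnnihilation_anticomm, superCreation_anticomm, dotProduct_comm,
    star_eigvec_dotProduct]
  simp only [eq_comm (a := j)]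
  split_ifs
  · module
  · module

/-- The mixed terms give (tanh 2βε_i + tanh 2βε_j) times the pairing of the conjugate eigenvectors.
It vanishes because tanh is odd and the pairing is supported on ε_i = -ε_j. -/
theorem normalAnnihilation_anticomm (hanti : hᵀ = -h) (β : ℝ) (i j : Fin (2 * n)) :
    normalAnnihilation hh β i * normalAnnihilation hh β j +
      normalAnnihilation hh β j * normalAnnihilation hh β i = 0 := by
  set u := star (eigvec hh i) with hu
  set v := star (eigvec hh j) with hv
  have h1 : normalAnnihilation hh β i * normalAnnihilation hh β j +
      normalAnnihilation hh β j * normalAnnihilation hh β i = (1 / 4 : ℂ) •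
      ((superAnnihilation n u * superAnnihilation n v +
          superAnnihilation n v * superAnnihilation n u) +
        modeTanh β (hh.eigenvalues j) • (superCreation n v * superAnnihilation n u +
          superAnnihilation n u * superCreation n v) +
        modeTanh β (hh.eigenvalues i) • (superCreation n u * superAnnihilation n v +
          superAnnihilation n v * superCreation n u) +
        (modeTanh β (hh.eigenvalues i) * modeTanh β (hh.eigenvalues j)) •
          (superCreation n u * superCreation n v + superCreation n v * superCreation n u)) := by
    simp only [normalAnnihilation, mul_add, add_mul,
      smul_mul_assoc, mul_smul_comm]
    module
  have h2 := mul_star_dotProduct hh hanti (modeTanh β) i j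
  rw [modeTanh_neg] at h2
  rw [h1, superCreation_superAnnihilation_anticomm, superCreation_superAnnihilation_anticomm,
    superCreation_anticomm, superAnnihilation_anticomm, dotProduct_comm v u]
  simp only [smul_smul, smul_zero, zero_add, add_zero, ← add_smul]
  convert zero_smul ℂ (1 : Module.End ℂ (FockOp n)) using 2
  linear_combination h2

/-- Here `g` is the rate and `g'` its reflection ε ↦ -ε. The antisymmetric cc terms `p` see only the
odd part of the rate, the cd terms only the even part. -/
theorem sum_smul_symmetrize {ι M : Type*} [Fintype ι] [AddCommGroup M] [Module ℂ M]
    {g g' : ι → ℂ} {p u v : ι → M} (huv : ∑ i, g i • v i = ∑ i, g' i • u i)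
    (hp : -∑ i, g i • p i = ∑ i, g' i • p i) :
    ∑ i, g i • ((1 / 2 : ℂ) • p i - (1 / 4 : ℂ) • (u i + v i)) =
      (1 / 4 : ℂ) • ∑ i, (g i - g' i) • p i - (1 / 4 : ℂ) • ∑ i, (g i + g' i) • u i := by
  have h1 : ∑ i, g i • ((1 / 2 : ℂ) • p i - (1 / 4 : ℂ) • (u i + v i)) =
      (1 / 2 : ℂ) • ∑ i, g i • p i - (1 / 4 : ℂ) • (∑ i, g i • u i + ∑ i, g i • v i) := by
    rw [← Finset.sum_add_distrib, Finset.smul_sum, Finset.smul_sum, ← Finset.sum_sub_distrib]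
    exact Finset.sum_congr rfl fun i _ => by module
  simp only [h1, sub_smul, add_smul, Finset.sum_sub_distrib, Finset.sum_add_distrib, huv, ← hp]
  module

theorem freeLindbladian_eq_sum_normal (hanti : hᵀ = -h) (β : ℝ) {q : ℝ → ℝ}
    (hq : ∀ ν, q (-ν) = q ν) :
    freeLindbladian hh β q = ∑ i, (-2 * (modeDecay β q (hh.eigenvalues i) : ℂ)) •
      (normalCreation hh i * normalAnnihilation hh β i) := by
  have h1 : freeLindbladian hh β q = ∑ i, modeRate β q (hh.eigenvalues i) •
      ((1 / 2 : ℂ) • (superCreation n (eigvec hh i) * superCreation n (star (eigvec hh i))) -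
        (1 / 4 : ℂ) • (superCreation n (eigvec hh i) * superAnnihilation n (star (eigvec hh i)) +
          superCreation n (star (eigvec hh i)) * superAnnihilation n (eigvec hh i))) := by
    refine LinearMap.ext fun X => ?_
    rw [freeLindbladian_eq_sum_dissipator hh hanti, LinearMap.sum_apply]
    refine Finset.sum_congr rfl fun i _ => ?_
    rw [LinearMap.smul_apply, ← dissipator_majoranaComb, ← majoranaComb_conjTranspose, eigenmode]
    rw [dotProduct_comm, star_eigvec_dotProduct, if_pos rfl]
  have h2 := sum_bilin_star_eigvec hh hanti ((LinearMap.mul ℂ (Module.End ℂ (FockOp n))).compl₁₂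
    (superCreation n) (superAnnihilation n)) (modeRate β q)
  have h3 := sum_bilin_star_eigvec hh hanti ((LinearMap.mul ℂ (Module.End ℂ (FockOp n))).compl₁₂
    (superCreation n) (superCreation n)) (modeRate β q)
  simp only [LinearMap.compl₁₂_apply, LinearMap.mul_apply'] at h2 h3
  simp only [eq_neg_of_add_eq_zero_left (superCreation_anticomm (star (eigvec hh _)) _), smul_neg,
    Finset.sum_neg_distrib] at h3
  rw [h1, sum_smul_symmetrize h2 h3, Finset.smul_sum, Finset.smul_sum, ← Finset.sum_sub_distrib]
  refine Finset.sum_congr rfl fun i _ => ?_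
  -- The odd part of the rate is -tanh(2βε) times the even part, which is exactly the shift built
  -- into `normalAnnihilation`.
  rw [modeRate_add_neg β hq, modeRate_sub_neg β hq]
  simp only [normalCreation, normalAnnihilation, mul_add, smul_mul_assoc, mul_smul_comm]
  module

theorem finrank_fockOp (n : ℕ) : Module.finrank ℂ (FockOp n) = 2 ^ (2 * n) := by
  rw [Module.finrank_matrix]
  simp
  ring

theorem exists_freeLindbladian_eigenbasis (hanti : hᵀ = -h) (β : ℝ) {q : ℝ → ℝ}
    (hq : ∀ ν, q (-ν) = q ν) :
    ∃ b : Module.Basis (Fin (2 * n) → Fin 2) ℂ (FockOp n), ∀ x, freeLindbladian hh β q (b x) =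
      ((∑ i, (-1 + (-1) ^ (x i : ℕ)) * modeDecay β q (hh.eigenvalues i) : ℝ) : ℂ) • b x := by
  obtain ⟨b, hb⟩ := exists_occupation_basis (normalCreation_anticomm hh)
    (normalAnnihilation_anticomm hh hanti β) (normalCreation_normalAnnihilation_anticomm hh β)
    (finrank_fockOp n)
  refine ⟨b, fun x => ?_⟩
  rw [freeLindbladian_eq_sum_normal hh hanti β hq, LinearMap.sum_apply, Complex.ofReal_sum,
    Finset.sum_smul]
  refine Finset.sum_congr rfl fun i _ => ?_
  rw [LinearMap.smul_apply, hb, smul_smul]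
  congr 1
  generalize x i = y
  fin_cases y
  · simp
  · norm_num

end Spectrum

/-! ### The two extreme gaps -/

section Gaps

/-- The hypotheses compare labels rather than values, so coinciding eigenvalues keep their
multiplicity. -/
theorem sort_map_univ {κ : Type*} [Fintype κ] [DecidableEq κ] (r : ℝ → ℝ → Prop) [DecidableRel r]
    [IsTrans ℝ r] [Std.Antisymm r] [Std.Total r] {μ : κ → ℝ} {x₀ x₁ : κ} (hne : x₁ ≠ x₀)
    (h₁ : ∀ x, x ≠ x₀ → r (μ x₁) (μ x)) (h₀ : r (μ x₀) (μ x₁)) :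
    ∃ l, (Finset.univ.val.map μ).sort r = μ x₀ :: μ x₁ :: l := by
  have h2 : (Finset.univ : Finset κ).val =
      x₀ ::ₘ x₁ ::ₘ ((Finset.univ.erase x₀).erase x₁).val := by
    rw [Finset.erase_val, Multiset.cons_erase, Finset.erase_val, Multiset.cons_erase]
    · simp
    · exact (Multiset.mem_erase_of_ne hne).2 (Finset.mem_univ x₁)
  rw [h2, Multiset.map_cons, Multiset.map_cons]
  refine ⟨_, sort_cons_cons r h₀ fun c hc => ?_⟩
  obtain ⟨x, hx, rfl⟩ := Multiset.mem_map.1 hc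
  exact h₁ x (Finset.mem_erase.1 (Finset.mem_erase.1 hx).2).1

variable {m : ℕ}

/-- The eigenvalue of `-2 ∑ κ_i N_i` at the occupation string `x`. -/
noncomputable def occupationEnergy (κ : Fin m → ℝ) (x : Fin m → Fin 2) : ℝ :=
  ∑ i, (-1 + (-1) ^ (x i : ℕ)) * κ i

theorem occupationEnergy_zero (κ : Fin m → ℝ) : occupationEnergy κ 0 = 0 := by
  simp [occupationEnergy]

theorem occupationEnergy_single (κ : Fin m → ℝ) (i : Fin m) :
    occupationEnergy κ (Pi.single i 1) = -2 * κ i := by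
  rw [occupationEnergy, Finset.sum_eq_single i]
  · norm_num
  · intro j _ hj
    simp [hj]
  · simp

/-- Particle–hole reflection, which reduces the bottom gap to the top gap. -/
theorem occupationEnergy_one_sub (κ : Fin m → ℝ) (x : Fin m → Fin 2) :
    occupationEnergy κ (1 - x) = -2 * ∑ i, κ i - occupationEnergy κ x := by
  rw [occupationEnergy, occupationEnergy, Finset.mul_sum, ← Finset.sum_sub_distrib]
  refine Finset.sum_congr rfl fun i _ => ?_
  rw [Pi.sub_apply, Pi.one_apply]
  generalize x i = y
  fin_cases y
  · norm_num
  · norm_num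

theorem occupationEnergy_le {κ : Fin m → ℝ} (hκ : ∀ i, 0 ≤ κ i) {x : Fin m → Fin 2} {i : Fin m}
    (hx : x i ≠ 0) : occupationEnergy κ x ≤ -2 * κ i := by
  have h1 : x i = 1 := by
    generalize x i = y at hx
    fin_cases y
    · exact absurd rfl hx
    · rfl
  have hneg : ∀ j, (-1 + (-1) ^ (x j : ℕ)) * κ j ≤ 0 := fun j => by
    refine mul_nonpos_of_nonpos_of_nonneg ?_ (hκ j)
    rcases neg_one_pow_eq_or ℝ (x j : ℕ) with h | h <;> norm_num [h]
  have h2 := Finset.add_sum_erase Finset.univ (fun j => (-1 + (-1) ^ (x j : ℕ)) * κ j)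
    (Finset.mem_univ i)
  have h3 := Finset.sum_nonpos fun j (_ : j ∈ Finset.univ.erase i) => hneg j
  have h4 : (-1 + (-1) ^ (x i : ℕ)) * κ i = -2 * κ i := by
    rw [h1]
    norm_num
  rw [occupationEnergy, ← h2, h4]
  linarith

theorem occupationEnergy_gap {κ : Fin m → ℝ} (hκ : ∀ i, 0 ≤ κ i) {i : Fin m}
    (hi : ∀ j, κ i ≤ κ j) {x : Fin m → Fin 2} (hx : x ≠ 0) :
    occupationEnergy κ x ≤ occupationEnergy κ (Pi.single i 1) := by
  obtain ⟨j, hj⟩ := Function.ne_iff.1 hx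
  rw [occupationEnergy_single]
  linarith [occupationEnergy_le hκ hj, hi j]

variable {V : Type*} [AddCommGroup V] [Module ℂ V] [Module.Finite ℂ V] [Module.Free ℂ V]

theorem gaps_of_occupationEnergy [NeZero m] {T : Module.End ℂ V} {κ : Fin m → ℝ}
    (hκ : ∀ i, 0 ≤ κ i)
    (hT : eigenvalueMultiset T = Finset.univ.val.map fun x => (occupationEnergy κ x : ℂ)) :
    topGap T = 2 * ⨅ i, κ i ∧ bottomGap T = 2 * ⨅ i, κ i := by
  obtain ⟨i, hi⟩ := Finite.exists_min κ
  have hinf : ⨅ j, κ j = κ i :=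
    le_antisymm (ciInf_le (Set.finite_range κ).bddBelow i) (le_ciInf hi)
  have hre : (eigenvalueMultiset T).map Complex.re =
      Finset.univ.val.map (occupationEnergy κ) := by
    rw [hT, Multiset.map_map]
    exact Multiset.map_congr rfl fun x _ => Complex.ofReal_re _
  have hne : (Pi.single i 1 : Fin m → Fin 2) ≠ 0 := by simp
  have h0 : occupationEnergy κ (Pi.single i 1) ≤ occupationEnergy κ 0 := by
    rw [occupationEnergy_single, occupationEnergy_zero]
    linarith [hκ i]
  constructor
  · obtain ⟨l, hl⟩ := sort_map_univ (fun a b : ℝ => b ≤ a) (μ := occupationEnergy κ) hne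
      (fun x hx => occupationEnergy_gap hκ hi hx) h0
    -- The sorted list has at least two entries, so the default values of `getD` play no role.
    simp only [topGap, hre, hl, hinf]
    simp [occupationEnergy_zero, occupationEnergy_single]
  · obtain ⟨l, hl⟩ := sort_map_univ (fun a b : ℝ => a ≤ b) (μ := occupationEnergy κ)
      (x₀ := 1 - 0) (x₁ := 1 - Pi.single i 1) (fun h => hne (sub_right_injective h))
      (fun x hx => by
        have h1 := occupationEnergy_gap hκ hi (x := 1 - x)
          (fun h => hx (by rw [← h, sub_sub_cancel]))
        rw [occupationEnergy_one_sub] at h1 ⊢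
        linarith)
      (by
        rw [occupationEnergy_one_sub, occupationEnergy_one_sub]
        linarith)
    simp only [bottomGap, hre, hl, hinf, occupationEnergy_one_sub, occupationEnergy_zero,
      occupationEnergy_single]
    simp

end Gaps

theorem mainTheorem4 (n : ℕ) (hn : 0 < n) (h : Matrix (Fin (2 * n)) (Fin (2 * n)) ℂ)
    (hh : h.IsHermitian) (hanti : hᵀ = -h) (β : ℝ) (q : ℝ → ℝ) (hq : ∀ ν, q (-ν) = q ν) :
    -- the spectrum, with multiplicities and as a set
    eigenvalueMultiset (freeLindbladian hh β q) =
      (Finset.univ : Finset (Fin (2 * n) → Fin 2)).val.map (fun x =>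
        ((∑ i, (-1 + (-1) ^ (x i : ℕ)) *
          (q (4 * hh.eigenvalues i) ^ 2 * Real.cosh (2 * β * hh.eigenvalues i)) : ℝ) : ℂ)) ∧
    spectrum ℂ (freeLindbladian hh β q) =
      Set.range (fun x : Fin (2 * n) → Fin 2 =>
        ((∑ i, (-1 + (-1) ^ (x i : ℕ)) *
          (q (4 * hh.eigenvalues i) ^ 2 * Real.cosh (2 * β * hh.eigenvalues i)) : ℝ) : ℂ)) ∧
    -- the spectral gap, which is the same at both ends of the spectrum
    topGap (freeLindbladian hh β q) =
      2 * ⨅ i, q (4 * hh.eigenvalues i) ^ 2 * Real.cosh (2 * β * hh.eigenvalues i) ∧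
    bottomGap (freeLindbladian hh β q) =
      2 * ⨅ i, q (4 * hh.eigenvalues i) ^ 2 * Real.cosh (2 * β * hh.eigenvalues i) ∧
    -- the Gibbs state is a fixed point, and the only one when the filter does not vanish
    IsDensityMatrix (gibbsState β (freeHamiltonian h)) ∧
    freeLindbladian hh β q (gibbsState β (freeHamiltonian h)) = 0 ∧
    ((∀ i, q (4 * hh.eigenvalues i) ≠ 0) →
      LinearMap.ker (freeLindbladian hh β q) =
        Submodule.span ℂ {gibbsState β (freeHamiltonian h)} ∧
      ∀ ρ : FockOp n, IsDensityMatrix ρ → freeLindbladian hh β q ρ = 0 →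
        ρ = gibbsState β (freeHamiltonian h)) := by
  obtain ⟨b, hb⟩ := exists_freeLindbladian_eigenbasis hh hanti β hq
  have hroots := eigenvalueMultiset_of_basis b hb
  set κ : Fin (2 * n) → ℝ := fun i => modeDecay β q (hh.eigenvalues i) with hκdef
  have hκ : ∀ i, 0 ≤ κ i := fun i => mul_nonneg (sq_nonneg _) (Real.cosh_pos _).le
  have : NeZero (2 * n) := ⟨by omega⟩
  have hgaps := gaps_of_occupationEnergy hκ hroots
  have hσ := gibbsState_isDensityMatrix (freeHamiltonian_isHermitian hh) β
  have hσ0 : freeLindbladian hh β q (gibbsState β (freeHamiltonian h)) = 0 := by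
    rw [gibbsState, map_smul, freeLindbladian_exp hh hanti β hq, smul_zero]
  refine ⟨hroots, ?_, hgaps.1, hgaps.2, hσ, hσ0, fun hq0 => ?_⟩
  · ext z
    rw [Module.End.mem_spectrum_iff_isRoot_charpoly,
      ← Polynomial.mem_roots (LinearMap.charpoly_monic _).ne_zero]
    change z ∈ eigenvalueMultiset _ ↔ _
    rw [hroots, Multiset.mem_map]
    simp [modeDecay]
  · have hne : gibbsState β (freeHamiltonian h) ≠ 0 := fun h0 => by
      have := hσ.2
      simp [h0] at this
    -- A nonempty string occupies some mode `j`, so its eigenvalue is at most -2κ_j < 0.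
    have hker := ker_eq_span_of_basis b hb (x₀ := 0) (fun x hx => by
      obtain ⟨j, hj⟩ := Function.ne_iff.1 hx
      have hpos : 0 < κ j := mul_pos (sq_pos_of_ne_zero (hq0 j)) (Real.cosh_pos _)
      have := occupationEnergy_le hκ hj
      exact Complex.ofReal_ne_zero.2 (ne_of_lt (by
        change occupationEnergy κ x < 0
        linarith))) hσ0 hne
    refine ⟨hker, fun ρ hρ hρ0 => ?_⟩
    have hmem : ρ ∈ LinearMap.ker (freeLindbladian hh β q) := hρ0
    rw [hker] at hmem
    obtain ⟨c, rfl⟩ := Submodule.mem_span_singleton.1 hmem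
    -- The trace condition forces the scalar to be 1.
    have htr := hρ.2
    rw [Matrix.trace_smul, hσ.2, smul_eq_mul, mul_one] at htr
    rw [htr, one_smul]
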